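/- Fix integers $D\ge 0$, $d_{\rm loc}\ge 2$, $r\ge 0$, $k\ge 1$, $p\ge 1$ and positive constants $a,b,c,\delta_1,\delta_2,\delta_3,\epsilon,M$. **Setting.** Consider $N$ spins of local dimension $d_{\rm loc}$ placed on $N$ distinct sites of a $D$-dimensional hypercubic lattice (each direction may be open or periodic), with Hilbert space dimension $d=d_{\rm loc}^N$. Let $H=\sum_{i\in I}H_i$ be a Hamiltonian, where $I$ is a set of at least $aN$ sites and each $H_i$ is Hermitian, traceless, supported on the sites within $\ell^\infty$-distance $r$ of $i$, and satisfies $b\le\|H_i\|\le c$. Let $\{|j\rangle\}_{j=1}^d$ be an orthonormal basis of eigenstates of $H$ with energies $E_j$. Let $A$ be a traceless operator with $\|A\|=1$, supported on the sites within distance $r$ of some site, and put $A_{jj}=\langle j|A|j\rangle$. Let $J=\{j:-N\delta_1\le E_j\le N\delta_2\}$, $K_j=\{k:|E_j-E_k|\le N\delta_3\}$ and $$\Delta A_J=\frac1{|J|}\sum_{j\in J}\Big|A_{jj}-\frac1{|J|}\sum_{k\in J}A_{kk}\Big|^2,\qquad \Delta'A_J=\frac1{|J|}\sum_{j\in J}\Big|A_{jj}-\frac1{|K_j|}\sum_{k\in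 K_j}A_{kk}\Big|^2 .$$ **Assumption (eigenstate thermalization in the middle of the spectrum).** There is a function $f_A:[-\epsilon,\epsilon]\to\{z\in\mathbb C:|z|\le1\}$ with $|A_{jj}-f_A(E_j/N)|\le M/N^p$ for all $j$ with $|E_j|\le N\epsilon$, and $f_A$ has a Taylor expansion of order $k$ around $0$: there are complex numbers $t_0,\dots,t_k$ with $|t_m|\le M$ and $|f_A(x)-\sum_{m=0}^k t_mx^m|\le M|x|^{k+1}$ for $|x|\le\epsilon$. **Theorem.** (1) Under this assumption $$\Delta A_J=\frac{|\operatorname{tr}(HA)|^2}{d\,\operatorname{tr}(H^2)}+O(1/N^2),\qquad \Delta'A_J=\frac{|\operatorname{tr}(HA)|^2}{d\,\operatorname{tr}(H^2)}+O(1/N^2)$$ (the quotient being read as $0$ if $H=0$). (2) If in addition $|\operatorname{tr}(HA)|\ge\kappa d$ for a constant $\kappa>0$ (the generic case), then $\Delta A_J=\Theta(1/N)$ and $\Delta'A_J=\Theta(1/N)$; (3) in particular, for every constant $K$, both exceed $K d^{-1/2}$ for all sufficiently large $N$. The implied constants and the threshold on $N$ depend only on the constants fixed at the start (in (2) also on $\kappa$,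 in (3) also on $\kappa$ and $K$), and not on the particular lattice, $H$, eigenbasis, $A$ or $f_A$. -/

import Mathlib

noncomputable section

/-- `A` is supported on the set `S` of sites: it is of the form `B ⊗ 1`, with `B` acting on the
spins in `S` and the identity acting on the spins outside `S`. -/
def SupportedOn {V : Type*} {q : ℕ} (S : Set V)
    (A : Matrix (V → Fin q) (V → Fin q) ℂ) : Prop :=
  ∃ B : (S → Fin q) → (S → Fin q) → ℂ, ∀ x y : V → Fin q,
    ((∀ i, i ∉ S → x i = y i) → A x y = B (fun i => x i) (fun i => y i)) ∧
    ((∃ i, i ∉ S ∧ x i ≠ y i) → A x y = 0)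

/-- Operator norm of a matrix acting on the Hilbert space `ℂⁿ` with its Euclidean norm. -/
def opNorm {n : Type*} [Fintype n] [DecidableEq n] (A : Matrix n n ℂ) : ℝ :=
  ‖Matrix.toEuclideanCLM (n := n) (𝕜 := ℂ) A‖

/-- Variance of the numbers `a j`, `j ∈ J`. -/
def variance {ι : Type*} (J : Finset ι) (a : ι → ℂ) : ℝ :=
  (1 / (J.card : ℝ)) * ∑ j ∈ J, ‖a j - (1 / (J.card : ℂ)) * ∑ k ∈ J, a k‖ ^ 2

/-- Mean square deviation of the numbers `a j`, `j ∈ J`, from their local averages over `K j`. -/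
def localDeviation {ι : Type*} (J : Finset ι) (K : ι → Finset ι) (a : ι → ℂ) : ℝ :=
  (1 / (J.card : ℝ)) * ∑ j ∈ J, ‖a j - (1 / ((K j).card : ℂ)) * ∑ k ∈ K j, a k‖ ^ 2

/-- A finite system of spins of local dimension `q` in `D` dimensions, with a Hamiltonian and a
complete orthonormal set of eigenstates. The sites are a finite set of points of the hypercubic
lattice `∏ i, ℤ / L i`. The choice `L i = 0` gives `ℤ` in direction `i` (open boundary), and
`L i > 0` gives a periodic direction. -/
structure SpinSystem (D q : ℕ) where
  /-- the periods of the lattice (`0` for an open direction) -/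
  L : Fin D → ℕ
  /-- the lattice sites, each of which has a spin -/
  sites : Finset (∀ i, ZMod (L i))
  /-- the Hamiltonian -/
  H : Matrix (sites → Fin q) (sites → Fin q) ℂ
  /-- the eigenstates -/
  state : OrthonormalBasis (Fin (q ^ sites.card)) ℂ (EuclideanSpace ℂ (sites → Fin q))
  /-- the energies -/
  energy : Fin (q ^ sites.card) → ℝ
  eigen : ∀ j, Matrix.toEuclideanCLM (n := sites → Fin q) (𝕜 := ℂ) H (state j)
    = (energy j : ℂ) • state j

namespace SpinSystem

variable {D q : ℕ} (S : SpinSystem D q)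

/-- Operators on the Hilbert space of the system. -/
abbrev Op : Type := Matrix (S.sites → Fin q) (S.sites → Fin q) ℂ

/-- The number of spins. -/
def N : ℕ := S.sites.card

/-- The dimension of the Hilbert space. -/
def dim : ℕ := q ^ S.N

/-- The sites that are reached from `x` by a lattice translation with all coordinates at most `r`
in absolute value. -/
def nbhd (r : ℕ) (x : S.sites) : Set S.sites :=
  {y | ∃ t : Fin D → ℤ, (∀ i, |t i| ≤ (r : ℤ)) ∧ ∀ i, y.1 i = x.1 i + (t i : ZMod (S.L i))}

/-- `H = ∑ i ∈ I, h i` with at least `a * N` terms, each of which is Hermitian and traceless, is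
supported within distance `r` of its site, and has norm between `b` and `c`. -/
def HasLocalHamiltonian (r : ℕ) (a b c : ℝ) : Prop :=
  ∃ (I : Finset S.sites) (h : S.sites → S.Op),
    S.H = ∑ i ∈ I, h i ∧ a * (S.N : ℝ) ≤ (I.card : ℝ) ∧
    ∀ i ∈ I, (h i).IsHermitian ∧ (h i).trace = 0 ∧ SupportedOn (S.nbhd r i) (h i) ∧
      b ≤ opNorm (h i) ∧ opNorm (h i) ≤ c

/-- `A` is a traceless operator of norm `1`, supported within distance `r` of some site. -/
def IsLocalObservable (r : ℕ) (A : S.Op) : Prop :=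
  (∃ x : S.sites, SupportedOn (S.nbhd r x) A) ∧ A.trace = 0 ∧ opNorm A = 1

/-- The eigenstate expectation value `⟨j|A|j⟩`. -/
def eev (A : S.Op) (j : Fin (q ^ S.sites.card)) : ℂ :=
  inner ℂ (S.state j) (Matrix.toEuclideanCLM (n := S.sites → Fin q) (𝕜 := ℂ) A (S.state j))

/-- The microcanonical window `J = {j : - N δ₁ ≤ E j ≤ N δ₂}`. -/
def window (δ₁ δ₂ : ℝ) : Finset (Fin (q ^ S.sites.card)) :=
  {j | -((S.N : ℝ) * δ₁) ≤ S.energy j ∧ S.energy j ≤ (S.N : ℝ) * δ₂}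

/-- The window `K j = {k : |E j - E k| ≤ N δ₃}` around the `j`-th level. -/
def localWindow (δ₃ : ℝ) (j : Fin (q ^ S.sites.card)) : Finset (Fin (q ^ S.sites.card)) :=
  {k | |S.energy j - S.energy k| ≤ (S.N : ℝ) * δ₃}

/-- `ΔA_J`, the variance of the eigenstate expectation values in the window. -/
def fluct (δ₁ δ₂ : ℝ) (A : S.Op) : ℝ :=
  variance (S.window δ₁ δ₂) (S.eev A)

/-- `Δ'A_J`, the mean square deviation from the averages over the local windows. -/
def fluct' (δ₁ δ₂ δ₃ : ℝ) (A : S.Op) : ℝ :=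
  localDeviation (S.window δ₁ δ₂) (S.localWindow δ₃) (S.eev A)

/-- The leading term `|tr (H A)|² / (d tr (H²))`. -/
def leading (A : S.Op) : ℝ :=
  ‖(S.H * A).trace‖ ^ 2 / ((S.dim : ℝ) * (S.H * S.H).trace.re)

/-- Eigenstate thermalization for `A` in the middle of the spectrum: there is a function
`f : [-ε, ε] → {|z| ≤ 1}`, with a Taylor expansion of order `k` around `0` (coefficients and
remainder bounded through the constant `M`), such that `|A_jj - f (E_j / N)| ≤ M / N ^ p` whenever
`|E_j| ≤ N ε`. -/
def ETH (ε M : ℝ) (k p : ℕ) (A : S.Op) : Prop :=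
  ∃ f : ℝ → ℂ,
    (∀ x, |x| ≤ ε → ‖f x‖ ≤ 1) ∧
    (∃ t : ℕ → ℂ, (∀ m ≤ k, ‖t m‖ ≤ M) ∧
      ∀ x, |x| ≤ ε →
        ‖f x - ∑ m ∈ Finset.range (k + 1), t m * (x : ℂ) ^ m‖ ≤ M * |x| ^ (k + 1)) ∧
    ∀ j, |S.energy j| ≤ (S.N : ℝ) * ε →
      ‖S.eev A j - f (S.energy j / (S.N : ℝ))‖ ≤ M / (S.N : ℝ) ^ p

end SpinSystem

end

/-!
Let `x j = E j / N` be the energy density of a level, `a j = ⟨j|A|j⟩`, and write `𝔼` for the average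
over all `d` levels. The argument compares everything with this average over the whole spectrum.

*The leading term is the part of `𝔼 |a|²` explained by linear regression on `x`.* Since
`𝔼 (E a) = tr (H A) / d` and `𝔼 E² = tr (H²) / d`, the leading term is `|𝔼 (x a)|² / 𝔼 x²`. As
`𝔼 x = 0` and `𝔼 a = 0`, the difference `𝔼 |a|² - |𝔼 (x a)|² / 𝔼 x²` is the residual of the
regression, hence nonnegative and at most `𝔼 |a - u - s x|²` for all constants `u`, `s`
(`residual_le`). This needs no lower bound on `𝔼 x²`, which may be arbitrarily small because the
local terms may cancel.

*The residual is `O(1/N²)`.* Thermalization gives `|a - u - s x| ≤ M / N + L x²` with `u`, `s` the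
first two Taylor coefficients; outside `[-ε, ε]` such a bound is trivial
(`SpinSystem.ETH.exists_affine`). It remains to bound the fourth moment: `𝔼 x⁴ = O(1/N²)`. In
`tr (H⁴) = ∑ tr (h i * h j * h k * h l)` a term vanishes if the support of one factor is disjoint from
the other three supports, because that factor is traceless. The remaining quadruples form a graph on
four vertices without isolated vertices, which contains a perfect matching or a star, and there are
`O(N²)` of them (`norm_trace_pow_four_le`).

*The windows do not matter.* By Chebyshev's inequality for the fourth moment, all but a fraction
`O(1/N²)` of the levels satisfy `|x| ≤ θ`, with `θ` so small that these levels lie in `J` and in `K j`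
for each such `j`. As `𝔼 a = 0`, the averages of `a` over these windows are `O(1/N²)`, and both
fluctuation measures are `𝔼 |a|² + O(1/N²)` (`abs_localDeviation_sub_le`).

If `|tr (H A)| ≥ κ d`, the leading term is at least `κ² / (N² 𝔼 x²)`, which is of order `1/N` since
`𝔼 x² ≤ √(𝔼 x⁴) = O(1/N)`; the upper bound comes from `𝔼 |a|² ≤ 𝔼 |a - u|²`.
-/

open Finset
open scoped Kronecker

/-! ### Operators supported on a set of sites -/

lemma SupportedOn.mono {V : Type*} {q : ℕ} {S T : Set V} (hST : S ⊆ T)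
    {A : Matrix (V → Fin q) (V → Fin q) ℂ} (hA : SupportedOn S A) : SupportedOn T A := by
  classical
  obtain ⟨B, hB⟩ := hA
  refine ⟨fun u v => if ∀ i : T, i.1 ∉ S → u i = v i then
    B (fun i => u ⟨i.1, hST i.2⟩) (fun i => v ⟨i.1, hST i.2⟩) else 0, fun x y => ⟨fun h => ?_, ?_⟩⟩
  · dsimp only
    split_ifs with hxy
    · refine (hB x y).1 fun i hi => ?_
      by_cases hT : i ∈ T
      · exact hxy ⟨i, hT⟩ hi
      · exact h i hT
    · push Not at hxy
      obtain ⟨i, hi, hne⟩ := hxy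
      exact (hB x y).2 ⟨i.1, hi, hne⟩
  · rintro ⟨i, hi, hne⟩
    exact (hB x y).2 ⟨i, fun h => hi (hST h), hne⟩

open Classical in
/-- In the tensor decomposition of the Hilbert space into the spins inside and outside `S`, the
operators supported on `S` are the Kronecker products `B ⊗ 1`. -/
lemma supportedOn_iff_kronecker {V : Type*} [Fintype V] {q : ℕ} (S : Set V)
    (A : Matrix (V → Fin q) (V → Fin q) ℂ) :
    SupportedOn S A ↔ ∃ B : Matrix ({i // i ∈ S} → Fin q) ({i // i ∈ S} → Fin q) ℂ,
      A = (B ⊗ₖ (1 : Matrix ({i // i ∉ S} → Fin q) _ ℂ)).submatrix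
        (Equiv.piEquivPiSubtypeProd (· ∈ S) fun _ => Fin q)
        (Equiv.piEquivPiSubtypeProd (· ∈ S) fun _ => Fin q) := by
  refine exists_congr fun (B : Matrix ({i // i ∈ S} → Fin q) ({i // i ∈ S} → Fin q) ℂ) =>
    ⟨fun h => ?_, ?_⟩
  · ext x y
    simp only [Matrix.submatrix_apply, Matrix.kroneckerMap_apply, Matrix.one_apply,
      Equiv.piEquivPiSubtypeProd_apply]
    split_ifs with hxy
    · rw [mul_one]
      exact (h x y).1 fun i hi => congrFun hxy ⟨i, hi⟩
    · rw [mul_zero]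
      refine (h x y).2 ?_
      by_contra! hne
      exact hxy (funext fun i => hne i.1 i.2)
  · rintro rfl x y
    simp only [Matrix.submatrix_apply, Matrix.kroneckerMap_apply, Matrix.one_apply,
      Equiv.piEquivPiSubtypeProd_apply]
    refine ⟨fun h => ?_, fun ⟨i, hi, hne⟩ => ?_⟩
    · split_ifs with hxy
      · exact mul_one _
      · exact absurd (funext fun i : {i // i ∉ S} => h i.1 i.2) hxy
    · rw [if_neg (fun h => hne (congrFun h ⟨i, hi⟩)), mul_zero]

section Supports
variable {V : Type*} [Fintype V] [DecidableEq V] {q : ℕ}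

lemma SupportedOn.mul {S : Set V} {A B : Matrix (V → Fin q) (V → Fin q) ℂ}
    (hA : SupportedOn S A) (hB : SupportedOn S B) : SupportedOn S (A * B) := by
  classical
  rw [supportedOn_iff_kronecker] at *
  obtain ⟨A', rfl⟩ := hA
  obtain ⟨B', rfl⟩ := hB
  refine ⟨A' * B', ?_⟩
  rw [Matrix.submatrix_mul_equiv, ← Matrix.mul_kronecker_mul, one_mul]

/-- The trace of a product of operators on complementary sets of spins factorizes, so it vanishes if
one of them is traceless. -/
lemma SupportedOn.trace_mul_eq_zero (hq : q ≠ 0) {S : Set V}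
    {A X : Matrix (V → Fin q) (V → Fin q) ℂ} (hA : SupportedOn S A) (hX : SupportedOn Sᶜ X)
    (htr : A.trace = 0) : (A * X).trace = 0 := by
  classical
  have : NeZero q := ⟨hq⟩
  obtain ⟨C, hC⟩ := hX
  rw [supportedOn_iff_kronecker] at hA
  obtain ⟨B, hB⟩ := hA
  set e := Equiv.piEquivPiSubtypeProd (· ∈ S) fun _ : V => Fin q with he
  have hX' : X = ((1 : Matrix ({i // i ∈ S} → Fin q) _ ℂ) ⊗ₖ
      (Matrix.of C : Matrix ({i // i ∉ S} → Fin q) ({i // i ∉ S} → Fin q) ℂ)).submatrix e e := by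
    ext x y
    simp only [Matrix.submatrix_apply, Matrix.kroneckerMap_apply, Matrix.one_apply, he,
      Equiv.piEquivPiSubtypeProd_apply]
    split_ifs with hxy
    · rw [one_mul]
      exact (hC x y).1 fun i hi => congrFun hxy ⟨i, not_not.mp hi⟩
    · rw [zero_mul]
      refine (hC x y).2 ?_
      by_contra! hne
      exact hxy (funext fun i => hne i.1 (not_not.mpr i.2))
  have htrace : ∀ Y : Matrix (({i // i ∈ S} → Fin q) × ({i // i ∉ S} → Fin q)) _ ℂ,
      (Y.submatrix e e).trace = Y.trace := fun Y => by
    simp only [Matrix.trace, Matrix.diag_apply, Matrix.submatrix_apply]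
    exact Equiv.sum_comp e fun i => Y i i
  have hB0 : B.trace = 0 := by
    rw [hB, htrace, Matrix.trace_kronecker, Matrix.trace_one, mul_eq_zero] at htr
    refine htr.resolve_right ?_
    exact_mod_cast Fintype.card_ne_zero
  rw [hB, hX', Matrix.submatrix_mul_equiv, htrace, ← Matrix.mul_kronecker_mul, mul_one, one_mul,
    Matrix.trace_kronecker, hB0, zero_mul]

end Supports

/-! ### Traces and the operator norm -/

section Traces
variable {n : Type*} [Fintype n] [DecidableEq n]

lemma opNorm_mul_le (A B : Matrix n n ℂ) : opNorm (A * B) ≤ opNorm A * opNorm B := by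
  unfold opNorm
  rw [map_mul]
  exact norm_mul_le _ _

lemma trace_eq_sum_inner {ι : Type*} [Fintype ι] (A : Matrix n n ℂ)
    (b : OrthonormalBasis ι ℂ (EuclideanSpace ℂ n)) :
    A.trace = ∑ j, inner ℂ (b j) (Matrix.toEuclideanCLM (n := n) (𝕜 := ℂ) A (b j)) := by
  have h := LinearMap.trace_eq_sum_inner (Matrix.toEuclideanLin A) b
  refine Eq.trans ?_ h
  rw [Matrix.toEuclideanLin, Matrix.toLpLin_eq_toLin, Matrix.trace_toLin_eq]

lemma norm_inner_toEuclideanCLM_le (A : Matrix n n ℂ) {v : EuclideanSpace ℂ n} (hv : ‖v‖ = 1) :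
    ‖(inner ℂ v (Matrix.toEuclideanCLM (n := n) (𝕜 := ℂ) A v) : ℂ)‖ ≤ opNorm A := by
  refine (norm_inner_le_norm _ _).trans ?_
  rw [hv, one_mul]
  exact (ContinuousLinearMap.le_opNorm _ _).trans_eq (by rw [hv, mul_one]; rfl)

lemma norm_trace_le (A : Matrix n n ℂ) : ‖A.trace‖ ≤ Fintype.card n * opNorm A := by
  rw [trace_eq_sum_inner A (EuclideanSpace.basisFun n ℂ)]
  refine (norm_sum_le_of_le _ fun j _ =>
    norm_inner_toEuclideanCLM_le A ((EuclideanSpace.basisFun n ℂ).norm_eq_one j)).trans_eq ?_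
  simp

lemma norm_trace_mul_four_le {h₁ h₂ h₃ h₄ : Matrix n n ℂ} {c : ℝ} (hc : 0 ≤ c)
    (h1 : opNorm h₁ ≤ c) (h2 : opNorm h₂ ≤ c) (h3 : opNorm h₃ ≤ c) (h4 : opNorm h₄ ≤ c) :
    ‖(h₁ * h₂ * h₃ * h₄).trace‖ ≤ Fintype.card n * c ^ 4 := by
  refine (norm_trace_le _).trans (mul_le_mul_of_nonneg_left ?_ (by positivity))
  have nn : ∀ A : Matrix n n ℂ, 0 ≤ opNorm A := fun A => norm_nonneg _
  calc _ ≤ opNorm h₁ * opNorm h₂ * opNorm h₃ * opNorm h₄ := by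
        refine (opNorm_mul_le _ _).trans (mul_le_mul_of_nonneg_right ?_ (nn _))
        refine (opNorm_mul_le _ _).trans (mul_le_mul_of_nonneg_right ?_ (nn _))
        exact opNorm_mul_le _ _
    _ ≤ c * c * c * c := by
        have := nn h₁; have := nn h₂; have := nn h₃; have := nn h₄
        gcongr
    _ = c ^ 4 := by ring

end Traces

/-! ### The fourth moment of a sum of local operators -/

section FourthMoment
variable {V : Type*}

/-- For a nonnegative matrix `w` with row sums at most `g`, the total weight of the three perfect
matchings and the four spanning stars on the quadruples of indices is at most `7 g³ |I|²`. If `w` is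
the adjacency matrix of a graph, this counts the quadruples that contain such a subgraph. -/
lemma sum_connected_quadruples_le (I : Finset V) (w : V → V → ℝ) (g : ℝ) (hg : 1 ≤ g)
    (hw0 : ∀ i j, 0 ≤ w i j) (hw : ∀ i ∈ I, ∑ j ∈ I, w i j ≤ g) :
    ∑ i ∈ I, ∑ j ∈ I, ∑ k ∈ I, ∑ l ∈ I,
      (w i j * w k l + w i k * w j l + w i l * w j k + w i j * w i k * w i l
        + w j i * w j k * w j l + w k i * w k j * w k l + w l i * w l j * w l k)
      ≤ 7 * g ^ 3 * (I.card : ℝ) ^ 2 := by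
  have hI : (I.card : ℝ) ≤ (I.card : ℝ) ^ 2 := by
    exact_mod_cast Nat.le_self_pow two_ne_zero _
  have hr0 : ∀ i, 0 ≤ ∑ j ∈ I, w i j := fun i => Finset.sum_nonneg fun j _ => hw0 i j
  have htot0 : 0 ≤ ∑ i ∈ I, ∑ j ∈ I, w i j := Finset.sum_nonneg fun i _ => hr0 i
  have htot : ∑ i ∈ I, ∑ j ∈ I, w i j ≤ I.card * g :=
    (Finset.sum_le_sum hw).trans_eq (by simp)
  have hmatch : (∑ i ∈ I, ∑ j ∈ I, w i j) * (∑ i ∈ I, ∑ j ∈ I, w i j)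
      ≤ g ^ 3 * (I.card : ℝ) ^ 2 := by
    calc _ ≤ (I.card * g) * (I.card * g) := by gcongr
      _ = g ^ 2 * (I.card : ℝ) ^ 2 := by ring
      _ ≤ _ := by gcongr; norm_num
  have hstar : ∑ i ∈ I, (∑ j ∈ I, w i j) * (∑ j ∈ I, w i j) * (∑ j ∈ I, w i j)
      ≤ g ^ 3 * (I.card : ℝ) ^ 2 := by
    calc _ ≤ ∑ i ∈ I, g * g * g := by
          refine Finset.sum_le_sum fun i hi => ?_
          have := hr0 i
          have := hw i hi
          gcongr
      _ = g ^ 3 * I.card := by simp; ring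
      _ ≤ _ := by gcongr
  have s1 : ∑ i ∈ I, ∑ j ∈ I, ∑ k ∈ I, ∑ l ∈ I, w i j * w k l
      = (∑ i ∈ I, ∑ j ∈ I, w i j) * (∑ i ∈ I, ∑ j ∈ I, w i j) := by
    simp only [Finset.sum_mul, ← Finset.mul_sum]
  have s2 : ∑ i ∈ I, ∑ j ∈ I, ∑ k ∈ I, ∑ l ∈ I, w i k * w j l
      = (∑ i ∈ I, ∑ j ∈ I, w i j) * (∑ i ∈ I, ∑ j ∈ I, w i j) := by
    rw [← s1]; exact Finset.sum_congr rfl fun i _ => Finset.sum_comm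
  have s3 : ∑ i ∈ I, ∑ j ∈ I, ∑ k ∈ I, ∑ l ∈ I, w i l * w j k
      = (∑ i ∈ I, ∑ j ∈ I, w i j) * (∑ i ∈ I, ∑ j ∈ I, w i j) := by
    rw [← s2]; exact Finset.sum_congr rfl fun i _ => Finset.sum_congr rfl fun j _ => Finset.sum_comm
  have t1 : ∑ i ∈ I, ∑ j ∈ I, ∑ k ∈ I, ∑ l ∈ I, w i j * w i k * w i l
      = ∑ i ∈ I, (∑ j ∈ I, w i j) * (∑ j ∈ I, w i j) * (∑ j ∈ I, w i j) := by
    simp only [← Finset.mul_sum, ← Finset.sum_mul]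
  have t2 : ∑ i ∈ I, ∑ j ∈ I, ∑ k ∈ I, ∑ l ∈ I, w j i * w j k * w j l
      = ∑ i ∈ I, (∑ j ∈ I, w i j) * (∑ j ∈ I, w i j) * (∑ j ∈ I, w i j) := by
    rw [← t1]; exact Finset.sum_comm
  have t3 : ∑ i ∈ I, ∑ j ∈ I, ∑ k ∈ I, ∑ l ∈ I, w k i * w k j * w k l
      = ∑ i ∈ I, (∑ j ∈ I, w i j) * (∑ j ∈ I, w i j) * (∑ j ∈ I, w i j) := by
    rw [← t2]; exact Finset.sum_congr rfl fun i _ => Finset.sum_comm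
  have t4 : ∑ i ∈ I, ∑ j ∈ I, ∑ k ∈ I, ∑ l ∈ I, w l i * w l j * w l k
      = ∑ i ∈ I, (∑ j ∈ I, w i j) * (∑ j ∈ I, w i j) * (∑ j ∈ I, w i j) := by
    rw [← t3]; exact Finset.sum_congr rfl fun i _ => Finset.sum_congr rfl fun j _ => Finset.sum_comm
  simp only [Finset.sum_add_distrib, s1, s2, s3, t1, t2, t3, t4]
  linarith

/-- A graph on four vertices without isolated vertices contains a perfect matching or a spanning
star. The six numbers indicate the edges `12`, `13`, `14`, `23`, `24`, `34`. -/
lemma one_le_of_no_isolated {a b c d e f : ℝ} (ha : a = 0 ∨ a = 1) (hb : b = 0 ∨ b = 1)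
    (hc : c = 0 ∨ c = 1) (hd : d = 0 ∨ d = 1) (he : e = 0 ∨ e = 1) (hf : f = 0 ∨ f = 1)
    (h1 : a = 0 → b = 0 → c ≠ 0) (h2 : a = 0 → d = 0 → e ≠ 0)
    (h3 : b = 0 → d = 0 → f ≠ 0) (h4 : c = 0 → e = 0 → f ≠ 0) :
    1 ≤ a * f + b * e + c * d + a * b * c + a * d * e + b * d * f + c * e * f := by
  rcases ha with rfl | rfl <;> rcases hb with rfl | rfl <;> rcases hc with rfl | rfl <;>
    rcases hd with rfl | rfl <;> rcases he with rfl | rfl <;> rcases hf with rfl | rfl <;>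
    first
    | exact (h1 rfl rfl rfl).elim
    | exact (h2 rfl rfl rfl).elim
    | exact (h3 rfl rfl rfl).elim
    | exact (h4 rfl rfl rfl).elim
    | norm_num

variable [Fintype V] [DecidableEq V] {q : ℕ}

/-- A traceless operator whose support is disjoint from the supports of three others has zero
correlation with their product. -/
lemma trace_mul_three_eq_zero (hq : q ≠ 0) {S T₁ T₂ T₃ : Set V}
    {A B₁ B₂ B₃ : Matrix (V → Fin q) (V → Fin q) ℂ} (hA : SupportedOn S A) (htr : A.trace = 0)
    (h1 : SupportedOn T₁ B₁) (h2 : SupportedOn T₂ B₂) (h3 : SupportedOn T₃ B₃)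
    (d1 : Disjoint S T₁) (d2 : Disjoint S T₂) (d3 : Disjoint S T₃) :
    (A * (B₁ * B₂ * B₃)).trace = 0 :=
  hA.trace_mul_eq_zero hq (((h1.mono d1.subset_compl_left).mul (h2.mono d2.subset_compl_left)).mul
    (h3.mono d3.subset_compl_left)) htr

open Classical in
/-- The fourth moment of a sum of `n` traceless local operators is `O(n²)`: only those quadruples
contribute in which the support of each operator meets the support of another one. -/
lemma norm_trace_pow_four_le (hq : q ≠ 0) (I : Finset V) (U : V → Set V)
    (h : V → Matrix (V → Fin q) (V → Fin q) ℂ) {c : ℝ} (hc : 0 ≤ c)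
    (hsupp : ∀ i ∈ I, SupportedOn (U i) (h i)) (htr : ∀ i ∈ I, (h i).trace = 0)
    (hnorm : ∀ i ∈ I, opNorm (h i) ≤ c) {g : ℝ} (hg : 1 ≤ g)
    (hdeg : ∀ i ∈ I, (({j ∈ I | ¬ Disjoint (U i) (U j)} : Finset V).card : ℝ) ≤ g) :
    ‖((∑ i ∈ I, h i) * (∑ i ∈ I, h i) * (∑ i ∈ I, h i) * (∑ i ∈ I, h i)).trace‖
      ≤ 7 * g ^ 3 * (I.card : ℝ) ^ 2 * (Fintype.card (V → Fin q) * c ^ 4) := by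
  set w : V → V → ℝ := fun i j => if Disjoint (U i) (U j) then 0 else 1 with hw
  set D : ℝ := Fintype.card (V → Fin q) * c ^ 4 with hD
  have hD0 : 0 ≤ D := by positivity
  have hw0 : ∀ i j, 0 ≤ w i j := fun i j => by simp only [hw]; split_ifs <;> norm_num
  have hexp : ((∑ i ∈ I, h i) * (∑ i ∈ I, h i) * (∑ i ∈ I, h i) * (∑ i ∈ I, h i)).trace
      = ∑ i ∈ I, ∑ j ∈ I, ∑ k ∈ I, ∑ l ∈ I, (h i * h j * h k * h l).trace := by
    simp only [← Matrix.trace_sum, ← Finset.mul_sum, ← Finset.sum_mul]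
  have key : ∀ i ∈ I, ∀ j ∈ I, ∀ k ∈ I, ∀ l ∈ I, ‖(h i * h j * h k * h l).trace‖
      ≤ (w i j * w k l + w i k * w j l + w i l * w j k + w i j * w i k * w i l
        + w j i * w j k * w j l + w k i * w k j * w k l + w l i * w l j * w l k) * D := by
    intro i hi j hj k hk l hl
    have hbound := norm_trace_mul_four_le hc (hnorm i hi) (hnorm j hj) (hnorm k hk) (hnorm l hl)
    have hsymm : ∀ i j, w i j = w j i := fun i j => by simp only [hw, disjoint_comm]
    have c1 : (h i * h j * h k * h l).trace = (h i * (h j * h k * h l)).trace := by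
      simp only [mul_assoc]
    have c2 : (h i * h j * h k * h l).trace = (h j * (h k * h l * h i)).trace := by
      rw [c1, Matrix.trace_mul_comm]; simp only [mul_assoc]
    have c3 : (h i * h j * h k * h l).trace = (h k * (h l * h i * h j)).trace := by
      rw [c2, Matrix.trace_mul_comm]; simp only [mul_assoc]
    have c4 : (h i * h j * h k * h l).trace = (h l * (h i * h j * h k)).trace := by
      rw [c3, Matrix.trace_mul_comm]; simp only [mul_assoc]
    have hs : ∀ a b, w a b = 0 ∨ w a b = 1 := fun a b => by
      simp only [hw]; split_ifs <;> simp
    have hd : ∀ a b, w a b = 0 → Disjoint (U a) (U b) := fun a b hab => by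
      by_contra hne
      simp [hw, hne] at hab
    have z1 : w i j = 0 → w i k = 0 → w i l = 0 → (h i * h j * h k * h l).trace = 0 := by
      intro a b e
      rw [c1]
      exact trace_mul_three_eq_zero hq (hsupp i hi) (htr i hi) (hsupp j hj) (hsupp k hk)
        (hsupp l hl) (hd _ _ a) (hd _ _ b) (hd _ _ e)
    have z2 : w i j = 0 → w j k = 0 → w j l = 0 → (h i * h j * h k * h l).trace = 0 := by
      intro a b e
      rw [c2]
      exact trace_mul_three_eq_zero hq (hsupp j hj) (htr j hj) (hsupp k hk) (hsupp l hl)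
        (hsupp i hi) (hd _ _ b) (hd _ _ e) (hd _ _ a).symm
    have z3 : w i k = 0 → w j k = 0 → w k l = 0 → (h i * h j * h k * h l).trace = 0 := by
      intro a b e
      rw [c3]
      exact trace_mul_three_eq_zero hq (hsupp k hk) (htr k hk) (hsupp l hl) (hsupp i hi)
        (hsupp j hj) (hd _ _ e) (hd _ _ a).symm (hd _ _ b).symm
    have z4 : w i l = 0 → w j l = 0 → w k l = 0 → (h i * h j * h k * h l).trace = 0 := by
      intro a b e
      rw [c4]
      exact trace_mul_three_eq_zero hq (hsupp l hl) (htr l hl) (hsupp i hi) (hsupp j hj)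
        (hsupp k hk) (hd _ _ a).symm (hd _ _ b).symm (hd _ _ e).symm
    rw [hsymm j i, hsymm k i, hsymm k j, hsymm l i, hsymm l j, hsymm l k]
    by_cases ht : (h i * h j * h k * h l).trace = 0
    · rw [ht, norm_zero]
      refine mul_nonneg ?_ hD0
      have := hw0 i j; have := hw0 i k; have := hw0 i l
      have := hw0 j k; have := hw0 j l; have := hw0 k l
      positivity
    · refine hbound.trans (le_mul_of_one_le_left hD0 ?_)
      exact one_le_of_no_isolated (hs i j) (hs i k) (hs i l) (hs j k) (hs j l) (hs k l)
        (fun a b e => ht (z1 a b e)) (fun a b e => ht (z2 a b e)) (fun a b e => ht (z3 a b e))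
        (fun a b e => ht (z4 a b e))
  rw [hexp]
  calc _ ≤ ∑ i ∈ I, ∑ j ∈ I, ∑ k ∈ I, ∑ l ∈ I,
      (w i j * w k l + w i k * w j l + w i l * w j k + w i j * w i k * w i l
        + w j i * w j k * w j l + w k i * w k j * w k l + w l i * w l j * w l k) * D :=
        norm_sum_le_of_le _ fun i hi => norm_sum_le_of_le _ fun j hj =>
          norm_sum_le_of_le _ fun k hk => norm_sum_le_of_le _ fun l hl => key i hi j hj k hk l hl
    _ ≤ _ := by
        simp only [← Finset.sum_mul]
        refine mul_le_mul_of_nonneg_right ?_ hD0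
        refine sum_connected_quadruples_le I w g hg hw0 fun i hi => ?_
        refine le_trans (le_of_eq ?_) (hdeg i hi)
        rw [Finset.card_filter]
        push_cast
        exact Finset.sum_congr rfl fun j _ => by simp only [hw, ite_not]

end FourthMoment

/-! ### Linear regression and averages over windows -/

lemma norm_average_le_one {ι : Type*} (A : ι → ℂ) (hA1 : ∀ j, ‖A j‖ ≤ 1) (K : Finset ι) :
    ‖(1 / (K.card : ℂ)) * ∑ k ∈ K, A k‖ ≤ 1 := by
  rw [norm_mul, norm_div, norm_one, Complex.norm_natCast, one_div_mul_eq_div]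
  refine div_le_one_of_le₀ ?_ (by positivity)
  exact (norm_sum_le_of_le K fun j _ => hA1 j).trans_eq (by simp)

section Averages
variable {ι : Type*} [Fintype ι]

lemma norm_sub_sq_complex (z w : ℂ) :
    ‖z - w‖ ^ 2 = ‖z‖ ^ 2 - 2 * (z * (starRingEnd ℂ) w).re + ‖w‖ ^ 2 := by
  rw [← Complex.normSq_eq_norm_sq, ← Complex.normSq_eq_norm_sq, ← Complex.normSq_eq_norm_sq,
    Complex.normSq_sub]
  ring

lemma sum_norm_sub_const_sq (A : ι → ℂ) (u : ℂ) (hA : ∑ j, A j = 0) :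
    ∑ j, ‖A j - u‖ ^ 2 = ∑ j, ‖A j‖ ^ 2 + Fintype.card ι * ‖u‖ ^ 2 := by
  have h : ∑ j, (A j * (starRingEnd ℂ) u).re = 0 := by
    rw [← Complex.re_sum, ← Finset.sum_mul, hA]; simp
  simp only [norm_sub_sq_complex, Finset.sum_add_distrib, Finset.sum_sub_distrib,
    ← Finset.mul_sum, h]
  simp

lemma sum_norm_sub_linear_sq (A : ι → ℂ) (x : ι → ℝ) (s : ℂ) :
    ∑ j, ‖A j - s * x j‖ ^ 2 = ∑ j, ‖A j‖ ^ 2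
      - 2 * ((∑ j, (x j : ℂ) * A j) * (starRingEnd ℂ) s).re + ‖s‖ ^ 2 * ∑ j, x j ^ 2 := by
  have h : ∑ j, (A j * (starRingEnd ℂ) (s * x j)).re
      = ((∑ j, (x j : ℂ) * A j) * (starRingEnd ℂ) s).re := by
    rw [← Complex.re_sum, Finset.sum_mul]
    congr 1
    refine Finset.sum_congr rfl fun j _ => ?_
    rw [map_mul, Complex.conj_ofReal]; ring
  simp only [norm_sub_sq_complex, Finset.sum_add_distrib, Finset.sum_sub_distrib,
    ← Finset.mul_sum, h]
  rw [Finset.mul_sum]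
  simp [mul_pow]

lemma sum_mul_eq_zero_of_sum_sq (A : ι → ℂ) (x : ι → ℝ) (hx : ∑ j, x j ^ 2 = 0) :
    ∑ j, (x j : ℂ) * A j = 0 := by
  rw [Finset.sum_eq_zero_iff_of_nonneg (fun j _ => sq_nonneg _)] at hx
  refine Finset.sum_eq_zero fun j hj => ?_
  have : x j = 0 := by simpa using hx j hj
  simp [this]

/-- The part of `∑ |A|²` that is explained by the linear regression of `A` on `x` is at most the
whole. -/
lemma explained_le (A : ι → ℂ) (x : ι → ℝ) :
    ‖∑ j, (x j : ℂ) * A j‖ ^ 2 / ∑ j, x j ^ 2 ≤ ∑ j, ‖A j‖ ^ 2 := by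
  refine div_le_of_le_mul₀ (Finset.sum_nonneg fun j _ => sq_nonneg _)
    (Finset.sum_nonneg fun j _ => sq_nonneg _) ?_
  have h1 : ‖∑ j, (x j : ℂ) * A j‖ ≤ ∑ j, |x j| * ‖A j‖ := by
    refine (norm_sum_le _ _).trans_eq ?_
    simp
  calc ‖∑ j, (x j : ℂ) * A j‖ ^ 2 ≤ (∑ j, |x j| * ‖A j‖) ^ 2 := by gcongr
    _ ≤ (∑ j, |x j| ^ 2) * ∑ j, ‖A j‖ ^ 2 := Finset.sum_mul_sq_le_sq_mul_sq _ _ _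
    _ = _ := by simp [mul_comm]

/-- The residual of the regression of `A` on `x` is at most the square error of any affine
approximation `u + s x`. -/
lemma residual_le (A : ι → ℂ) (x : ι → ℝ) (hA : ∑ j, A j = 0) (hx : ∑ j, x j = 0) (u s : ℂ) :
    ∑ j, ‖A j‖ ^ 2 - ‖∑ j, (x j : ℂ) * A j‖ ^ 2 / ∑ j, x j ^ 2
      ≤ ∑ j, ‖A j - u - s * x j‖ ^ 2 := by
  have h0 : ∑ j, (A j - s * x j) = 0 := by
    rw [Finset.sum_sub_distrib, hA, ← Finset.mul_sum, ← Complex.ofReal_sum, hx]; simp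
  have h1 : ∑ j, ‖A j - s * x j‖ ^ 2 ≤ ∑ j, ‖A j - u - s * x j‖ ^ 2 := by
    simp only [sub_right_comm _ u]
    rw [sum_norm_sub_const_sq _ u h0]
    have : (0 : ℝ) ≤ Fintype.card ι * ‖u‖ ^ 2 := by positivity
    linarith
  refine le_trans ?_ h1
  rw [sum_norm_sub_linear_sq]
  set T := ∑ j, (x j : ℂ) * A j with hT
  set X := ∑ j, x j ^ 2 with hX
  have hX0 : 0 ≤ X := Finset.sum_nonneg fun j _ => sq_nonneg _
  rcases hX0.eq_or_lt with h | h
  -- If `X = 0`, then the quotient is the junk value `0`, which is right because `T = 0` as well.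
  · have : T = 0 := sum_mul_eq_zero_of_sum_sq A x h.symm
    rw [← h, this]; simp
  · have h2 : (T * (starRingEnd ℂ) s).re ≤ ‖T‖ * ‖s‖ := by
      refine (Complex.re_le_norm _).trans_eq ?_
      simp
    have h3 : 0 ≤ (‖T‖ - ‖s‖ * X) ^ 2 / X := by positivity
    have h4 : (‖T‖ - ‖s‖ * X) ^ 2 / X = ‖T‖ ^ 2 / X - 2 * (‖T‖ * ‖s‖) + ‖s‖ ^ 2 * X := by
      field_simp
      ring
    linarith

/-- Chebyshev's inequality for the fourth moment. -/
lemma card_filter_gt_le [DecidableEq ι] (x : ι → ℝ) {θ Q : ℝ} (hθ : 0 < θ) (h4 : ∑ j, x j ^ 4 ≤ Q) :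
    ((univ.filter fun j => |x j| ≤ θ)ᶜ.card : ℝ) ≤ Q / θ ^ 4 := by
  rw [le_div_iff₀ (by positivity)]
  calc _ = ∑ j ∈ (univ.filter fun j => |x j| ≤ θ)ᶜ, θ ^ 4 := by simp
    _ ≤ ∑ j ∈ (univ.filter fun j => |x j| ≤ θ)ᶜ, x j ^ 4 := by
      refine Finset.sum_le_sum fun j hj => ?_
      have hj' : θ < |x j| := by simpa using hj
      have : |x j| ^ 4 = x j ^ 4 := by
        rw [← abs_pow, abs_of_nonneg (by positivity)]
      rw [← this]; gcongr
    _ ≤ ∑ j, x j ^ 4 :=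
      Finset.sum_le_sum_of_subset_of_nonneg (Finset.subset_univ _) fun _ _ _ => by positivity
    _ ≤ Q := h4

/-- If the numbers `A j` sum to zero, then their average over a set of almost full measure is
small. -/
lemma norm_average_le [DecidableEq ι] (A : ι → ℂ) (hA : ∑ j, A j = 0) (hA1 : ∀ j, ‖A j‖ ≤ 1)
    (hι : 0 < Fintype.card ι) {η : ℝ} (hη : η ≤ 1 / 2) (K : Finset ι)
    (hK : (Kᶜ.card : ℝ) ≤ η * Fintype.card ι) :
    ‖(1 / (K.card : ℂ)) * ∑ k ∈ K, A k‖ ≤ 2 * η := by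
  have hd : (0 : ℝ) < Fintype.card ι := by exact_mod_cast hι
  have hcard : (K.card : ℝ) + Kᶜ.card = Fintype.card ι := by
    exact_mod_cast Finset.card_add_card_compl K
  have hKpos : (Fintype.card ι : ℝ) / 2 ≤ K.card := by nlinarith
  have hη0 : 0 ≤ η := by
    by_contra! h
    have : (0 : ℝ) ≤ Kᶜ.card := by positivity
    nlinarith
  have hsum : ‖∑ k ∈ K, A k‖ ≤ Kᶜ.card := by
    have : ∑ k ∈ K, A k = - ∑ k ∈ Kᶜ, A k := by
      rw [eq_neg_iff_add_eq_zero, Finset.sum_add_sum_compl, hA]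
    rw [this, norm_neg]
    exact (norm_sum_le_of_le Kᶜ fun j _ => hA1 j).trans_eq (by simp)
  rw [norm_mul, norm_div, norm_one, Complex.norm_natCast, one_div_mul_eq_div,
    div_le_iff₀ (by linarith)]
  nlinarith

lemma abs_norm_sub_sq_sub_le {z m : ℂ} (hz : ‖z‖ ≤ 1) (hm : ‖m‖ ≤ 1) :
    |‖z - m‖ ^ 2 - ‖z‖ ^ 2| ≤ 3 * ‖m‖ := by
  have h := abs_norm_sub_norm_le (z - m) z
  rw [sub_sub_cancel_left, norm_neg] at h
  have h2 : ‖z - m‖ + ‖z‖ ≤ 3 := by linarith [norm_sub_le z m]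
  rw [sq_sub_sq, abs_mul, abs_of_nonneg (by positivity)]
  exact mul_le_mul h2 h (abs_nonneg _) (by norm_num)

/-- If every window contains a set `G` of almost full measure (for the local windows: every window
around a point of `G`), then the mean square deviation from the window averages agrees with the
second moment over the whole index set. -/
lemma abs_localDeviation_sub_le [DecidableEq ι] (A : ι → ℂ) (hA : ∑ j, A j = 0)
    (hA1 : ∀ j, ‖A j‖ ≤ 1)
    (hι : 0 < Fintype.card ι) {η : ℝ} (hη : η ≤ 1 / 2) (G J : Finset ι) (K : ι → Finset ι)
    (hG : (Gᶜ.card : ℝ) ≤ η * Fintype.card ι) (hJ : G ⊆ J) (hK : ∀ j ∈ G, G ⊆ K j) :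
    |localDeviation J K A - (∑ j, ‖A j‖ ^ 2) / Fintype.card ι| ≤ 22 * η := by
  have hd : (0 : ℝ) < Fintype.card ι := by exact_mod_cast hι
  have hcompl : ∀ T : Finset ι, G ⊆ T → (Tᶜ.card : ℝ) ≤ η * Fintype.card ι := fun T hT => by
    refine le_trans ?_ hG
    exact_mod_cast Finset.card_le_card (Finset.compl_subset_compl.mpr hT)
  have hη0 : 0 ≤ η := by
    by_contra! h
    have : (0 : ℝ) ≤ Gᶜ.card := by positivity
    nlinarith
  have hcard : (J.card : ℝ) + Jᶜ.card = Fintype.card ι := by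
    exact_mod_cast Finset.card_add_card_compl J
  have hJc := hcompl J hJ
  have hJpos : (Fintype.card ι : ℝ) / 2 ≤ J.card := by nlinarith
  unfold localDeviation
  set m : ι → ℂ := fun j => (1 / ((K j).card : ℂ)) * ∑ k ∈ K j, A k with hm
  have hm1 : ∀ j, ‖m j‖ ≤ 1 := fun j => norm_average_le_one A hA1 (K j)
  have hmG : ∀ j ∈ G, ‖m j‖ ≤ 2 * η := fun j hj =>
    norm_average_le A hA hA1 hι hη (K j) (hcompl _ (hK j hj))
  have hmsum : ∑ j ∈ J, ‖m j‖ ≤ 3 * η * Fintype.card ι := by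
    calc ∑ j ∈ J, ‖m j‖ ≤ ∑ j, ‖m j‖ :=
          Finset.sum_le_sum_of_subset_of_nonneg (Finset.subset_univ _) fun _ _ _ => norm_nonneg _
      _ = ∑ j ∈ G, ‖m j‖ + ∑ j ∈ Gᶜ, ‖m j‖ := (Finset.sum_add_sum_compl G _).symm
      _ ≤ ∑ j ∈ G, 2 * η + ∑ j ∈ Gᶜ, 1 := by
          gcongr with j hj j hj
          · exact hmG j hj
          · exact hm1 j
      _ = G.card * (2 * η) + Gᶜ.card := by simp
      _ ≤ Fintype.card ι * (2 * η) + η * Fintype.card ι := by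
          gcongr
          exact Finset.card_le_univ G
      _ = _ := by ring
  set S := ∑ j ∈ J, ‖A j - m j‖ ^ 2 with hS
  set W := ∑ j ∈ J, ‖A j‖ ^ 2 with hW
  have hSW : |S - W| ≤ 9 * η * Fintype.card ι := by
    rw [hS, hW, ← Finset.sum_sub_distrib]
    calc _ ≤ ∑ j ∈ J, |‖A j - m j‖ ^ 2 - ‖A j‖ ^ 2| := Finset.abs_sum_le_sum_abs _ _
      _ ≤ ∑ j ∈ J, 3 * ‖m j‖ :=
          Finset.sum_le_sum fun j _ => abs_norm_sub_sq_sub_le (hA1 j) (hm1 j)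
      _ = 3 * ∑ j ∈ J, ‖m j‖ := by rw [Finset.mul_sum]
      _ ≤ _ := by linarith
  have hsq : ∀ j, ‖A j‖ ^ 2 ≤ 1 := fun j => pow_le_one₀ (norm_nonneg _) (hA1 j)
  set T := ∑ j, ‖A j‖ ^ 2 with hT
  have hTW : T = W + ∑ j ∈ Jᶜ, ‖A j‖ ^ 2 := (Finset.sum_add_sum_compl J _).symm
  have hrest : ∑ j ∈ Jᶜ, ‖A j‖ ^ 2 ≤ Jᶜ.card := by
    refine (Finset.sum_le_sum fun j _ => hsq j).trans_eq (by simp)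
  have hrest0 : 0 ≤ ∑ j ∈ Jᶜ, ‖A j‖ ^ 2 := Finset.sum_nonneg fun _ _ => sq_nonneg _
  have hT0 : 0 ≤ T := Finset.sum_nonneg fun _ _ => sq_nonneg _
  have hTd : T ≤ Fintype.card ι := (Finset.sum_le_sum fun j _ => hsq j).trans_eq (by simp)
  generalize (Fintype.card ι : ℝ) = d at *
  set V := T / d with hV
  have hV0 : 0 ≤ V := by positivity
  have hV1 : V ≤ 1 := div_le_one_of_le₀ hTd hd.le
  have hTV : T = V * d := by rw [hV]; field_simp
  have hJ0 : (0 : ℝ) < J.card := by linarith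
  have hfin : |S - J.card * V| ≤ 11 * η * d := by
    rw [abs_le] at hSW ⊢
    have e1 : S - J.card * V = (S - W) - ∑ j ∈ Jᶜ, ‖A j‖ ^ 2 + Jᶜ.card * V := by
      have : (J.card : ℝ) = d - Jᶜ.card := by linarith
      rw [this]; linarith
    have e2 : (Jᶜ.card : ℝ) * V ≤ Jᶜ.card := mul_le_of_le_one_right (Nat.cast_nonneg _) hV1
    have e3 : 0 ≤ (Jᶜ.card : ℝ) * V := mul_nonneg (Nat.cast_nonneg _) hV0
    have e4 : 0 ≤ η * d := by positivity
    constructor <;> linarith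
  have e5 : 1 / (J.card : ℝ) * S - V = (S - J.card * V) / J.card := by
    rw [sub_div, mul_div_cancel_left₀ _ hJ0.ne', one_div_mul_eq_div]
  rw [e5, abs_div, abs_of_pos hJ0, div_le_iff₀ hJ0]
  nlinarith

lemma sum_sq_le_of_sum_pow_four_le (x : ι → ℝ) {b : ℝ} (hb : 0 ≤ b)
    (h4 : ∑ j, x j ^ 4 ≤ b ^ 2 * Fintype.card ι) : ∑ j, x j ^ 2 ≤ b * Fintype.card ι := by
  refine le_of_sq_le_sq ?_ (by positivity)
  calc (∑ j, x j ^ 2) ^ 2 ≤ Fintype.card ι * ∑ j, (x j ^ 2) ^ 2 := sq_sum_le_card_mul_sum_sq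
    _ ≤ Fintype.card ι * (b ^ 2 * Fintype.card ι) := by
        gcongr
        simpa [← pow_mul] using h4
    _ = _ := by ring

/-- A bound `τ + L x²` on the error of an affine approximation turns into a mean square bound through
the fourth moment of `x`. -/
lemma sum_affine_error_le (A : ι → ℂ) (x : ι → ℝ) (u s : ℂ) {τ L Q : ℝ}
    (h : ∀ j, ‖A j - u - s * x j‖ ≤ τ + L * x j ^ 2)
    (h4 : ∑ j, x j ^ 4 ≤ Q * Fintype.card ι) :
    ∑ j, ‖A j - u - s * x j‖ ^ 2 ≤ (2 * τ ^ 2 + 2 * L ^ 2 * Q) * Fintype.card ι := by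
  calc _ ≤ ∑ j, (2 * τ ^ 2 + 2 * L ^ 2 * x j ^ 4) := by
        refine Finset.sum_le_sum fun j _ => ?_
        calc _ ≤ (τ + L * x j ^ 2) ^ 2 := by gcongr; exact h j
          _ ≤ _ := by nlinarith [sq_nonneg (τ - L * x j ^ 2)]
    _ = 2 * τ ^ 2 * Fintype.card ι + 2 * L ^ 2 * ∑ j, x j ^ 4 := by
        rw [Finset.sum_add_distrib, Finset.sum_const, Finset.card_univ, nsmul_eq_mul,
          Finset.mul_sum, mul_comm]
    _ ≤ 2 * τ ^ 2 * Fintype.card ι + 2 * L ^ 2 * (Q * Fintype.card ι) := by gcongr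
    _ = _ := by ring

lemma sum_norm_sub_const_sq_le (A : ι → ℂ) (x : ι → ℝ) (u s : ℂ) {M : ℝ} (hs : ‖s‖ ≤ M) :
    ∑ j, ‖A j - u‖ ^ 2 ≤ 2 * ∑ j, ‖A j - u - s * x j‖ ^ 2 + 2 * M ^ 2 * ∑ j, x j ^ 2 := by
  rw [Finset.mul_sum, Finset.mul_sum, ← Finset.sum_add_distrib]
  refine Finset.sum_le_sum fun j _ => ?_
  have h3 : ‖A j - u‖ ≤ ‖A j - u - s * x j‖ + M * |x j| := by
    calc _ = ‖(A j - u - s * x j) + s * x j‖ := by rw [sub_add_cancel]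
      _ ≤ _ := by
          refine (norm_add_le _ _).trans (add_le_add le_rfl ?_)
          rw [norm_mul, Complex.norm_real, Real.norm_eq_abs]
          exact mul_le_mul_of_nonneg_right hs (abs_nonneg _)
  calc _ ≤ (‖A j - u - s * x j‖ + M * |x j|) ^ 2 := by gcongr
    _ ≤ 2 * (‖A j - u - s * x j‖ ^ 2 + (M * |x j|) ^ 2) := add_sq_le
    _ = _ := by rw [mul_pow, sq_abs]; ring

/-- The affine part of a Taylor expansion of order `k ≥ 1` has a quadratic remainder. -/
lemma norm_sub_affine_le {z : ℂ} {t : ℕ → ℂ} {k : ℕ} (hk : 1 ≤ k) {M ε x : ℝ} (hM : 0 ≤ M)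
    (ht : ∀ m ≤ k, ‖t m‖ ≤ M) (hx : |x| ≤ ε)
    (hz : ‖z - ∑ m ∈ range (k + 1), t m * (x : ℂ) ^ m‖ ≤ M * |x| ^ (k + 1)) :
    ‖z - t 0 - t 1 * x‖ ≤ (M * ∑ m ∈ range k, ε ^ m) * x ^ 2 := by
  obtain ⟨n, rfl⟩ := Nat.exists_eq_add_of_le' hk
  have e : z - t 0 - t 1 * x = (z - ∑ m ∈ range (n + 1 + 1), t m * (x : ℂ) ^ m)
      + ∑ m ∈ range n, t (m + 2) * (x : ℂ) ^ (m + 2) := by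
    rw [Finset.sum_range_succ', Finset.sum_range_succ']
    simp only [zero_add, pow_zero, pow_one]
    ring
  have hpow : ∀ m, |x| ^ (m + 2) ≤ ε ^ m * x ^ 2 := fun m => by
    rw [pow_add, sq_abs]; gcongr
  rw [e]
  calc _ ≤ M * |x| ^ (n + 2) + ∑ m ∈ range n, M * |x| ^ (m + 2) := by
        refine (norm_add_le _ _).trans (add_le_add hz (norm_sum_le_of_le _ fun m hm => ?_))
        rw [norm_mul, norm_pow, Complex.norm_real, Real.norm_eq_abs]
        gcongr
        exact ht _ (by have := Finset.mem_range.mp hm; omega)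
    _ = ∑ m ∈ range (n + 1), M * |x| ^ (m + 2) := by rw [Finset.sum_range_succ]; ring
    _ ≤ ∑ m ∈ range (n + 1), M * (ε ^ m * x ^ 2) :=
        Finset.sum_le_sum fun m _ => mul_le_mul_of_nonneg_left (hpow m) hM
    _ = _ := by rw [Finset.mul_sum, Finset.sum_mul]; exact Finset.sum_congr rfl fun m _ => by ring

end Averages

/-! ### Moments of the spectrum and of the eigenstate expectation values -/

namespace SpinSystem

variable {D q : ℕ} (S : SpinSystem D q)

lemma sum_eev (A : S.Op) : ∑ j, S.eev A j = A.trace := (trace_eq_sum_inner A S.state).symm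

lemma eev_mul_H (A : S.Op) (j) : S.eev (A * S.H) j = S.energy j * S.eev A j := by
  unfold eev
  rw [map_mul, mul_apply_eq_comp, S.eigen, map_smul, inner_smul_right]

lemma eev_one (j) : S.eev 1 j = 1 := by
  unfold eev
  rw [map_one, one_apply_eq_self, inner_self_eq_norm_sq_to_K, S.state.norm_eq_one]
  simp

lemma eev_H (j) : S.eev S.H j = S.energy j := by
  simpa [eev_one] using S.eev_mul_H 1 j

lemma norm_eev_le (A : S.Op) (j) : ‖S.eev A j‖ ≤ opNorm A :=
  norm_inner_toEuclideanCLM_le A (S.state.norm_eq_one j)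

lemma sum_energy : ((∑ j, S.energy j : ℝ) : ℂ) = S.H.trace := by
  rw [← sum_eev]; push_cast; simp only [eev_H]

lemma sum_energy_sq : ((∑ j, S.energy j ^ 2 : ℝ) : ℂ) = (S.H * S.H).trace := by
  rw [← sum_eev]; push_cast; simp only [eev_mul_H, eev_H]
  exact Finset.sum_congr rfl fun j _ => by ring

lemma sum_energy_pow_four :
    ((∑ j, S.energy j ^ 4 : ℝ) : ℂ) = (S.H * S.H * S.H * S.H).trace := by
  rw [← sum_eev]; push_cast; simp only [eev_mul_H, eev_H]
  exact Finset.sum_congr rfl fun j _ => by ring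

lemma sum_energy_mul_eev (A : S.Op) :
    ∑ j, (S.energy j : ℂ) * S.eev A j = (S.H * A).trace := by
  rw [Matrix.trace_mul_comm, ← sum_eev]; simp only [eev_mul_H]

lemma card_levels : Fintype.card (Fin (q ^ S.sites.card)) = S.dim := Fintype.card_fin _

lemma card_configurations : Fintype.card (S.sites → Fin q) = S.dim := by
  simp [dim, N]

open Classical in
/-- Only boundedly many neighbourhoods meet a given one: their centres are related by a translation
with coordinates at most `2 r`. -/
lemma card_not_disjoint_nbhd_le (r : ℕ) (i : S.sites) (I : Finset S.sites) :
    ({j ∈ I | ¬ Disjoint (S.nbhd r i) (S.nbhd r j)} : Finset S.sites).card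
      ≤ (4 * r + 1) ^ D := by
  set P : Finset (Fin D → ℤ) := Fintype.piFinset fun _ => Finset.Icc (-(2 * r : ℤ)) (2 * r)
    with hP
  have hcard : P.card = (4 * r + 1) ^ D := by
    rw [hP, Fintype.card_piFinset, Finset.prod_const, Int.card_Icc, Finset.card_univ,
      Fintype.card_fin]
    congr 1
    omega
  rw [← hcard]
  refine le_trans (Finset.card_le_card_of_injOn Subtype.val
    (t := P.image fun t a => i.1 a + (t a : ZMod (S.L a))) ?_ Subtype.val_injective.injOn)
    Finset.card_image_le
  intro j hj
  have hj' := (Finset.mem_filter.mp hj).2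
  rw [Set.not_disjoint_iff] at hj'
  obtain ⟨z, ⟨t, ht, hzt⟩, ⟨u, hu, hzu⟩⟩ := hj'
  refine Finset.mem_coe.mpr (Finset.mem_image.mpr ⟨fun a => t a - u a, ?_, ?_⟩)
  · rw [hP, Fintype.mem_piFinset]
    intro a
    have h1 := abs_le.mp (ht a)
    have h2 := abs_le.mp (hu a)
    rw [Finset.mem_Icc]
    constructor <;> linarith [h1.1, h1.2, h2.1, h2.2]
  · funext a
    have e : i.1 a + (t a : ZMod (S.L a)) = j.1 a + (u a : ZMod (S.L a)) := by
      rw [← hzt a, hzu a]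
    push_cast
    rw [← add_sub_assoc, e, add_sub_cancel_right]

/-- The constant in the bound `tr H⁴ / d ≤ Q N²` on the fourth moment of the energy. -/
noncomputable def fourthMomentConst (D r : ℕ) (c : ℝ) : ℝ :=
  7 * (((4 * r + 1) ^ D : ℕ) : ℝ) ^ 3 * c ^ 4

lemma fourthMomentConst_pos (D r : ℕ) {c : ℝ} (hc : 0 < c) : 0 < fourthMomentConst D r c := by
  unfold fourthMomentConst; positivity

variable {S}

lemma HasLocalHamiltonian.sum_energy_eq_zero {r : ℕ} {a b c : ℝ}
    (hS : S.HasLocalHamiltonian r a b c) : ∑ j, S.energy j = 0 := by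
  obtain ⟨I, h, hH, -, hI⟩ := hS
  have : S.H.trace = 0 := by
    rw [hH, Matrix.trace_sum]
    exact Finset.sum_eq_zero fun i hi => (hI i hi).2.1
  rw [← S.sum_energy] at this
  exact_mod_cast this

lemma HasLocalHamiltonian.sum_energy_pow_four_le (hq : q ≠ 0) {r : ℕ} {a b c : ℝ} (hc : 0 ≤ c)
    (hS : S.HasLocalHamiltonian r a b c) :
    ∑ j, S.energy j ^ 4 ≤ fourthMomentConst D r c * (S.N : ℝ) ^ 2 * S.dim := by
  classical
  obtain ⟨I, h, hH, -, hI⟩ := hS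
  have hg : (1 : ℝ) ≤ (((4 * r + 1) ^ D : ℕ) : ℝ) := by
    exact_mod_cast Nat.one_le_pow _ _ (by omega)
  have h4 := norm_trace_pow_four_le hq I (S.nbhd r) h hc (fun i hi => (hI i hi).2.2.1)
    (fun i hi => (hI i hi).2.1) (fun i hi => (hI i hi).2.2.2.2) hg
    (fun i _ => by exact_mod_cast S.card_not_disjoint_nbhd_le r i I)
  rw [← hH, ← S.sum_energy_pow_four, Complex.norm_real, Real.norm_eq_abs,
    S.card_configurations] at h4
  have hIN : (I.card : ℝ) ≤ S.N := by
    exact_mod_cast (Finset.card_le_univ I).trans_eq (by simp [N])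
  calc _ ≤ _ := le_abs_self _
    _ ≤ _ := h4
    _ ≤ 7 * (((4 * r + 1) ^ D : ℕ) : ℝ) ^ 3 * (S.N : ℝ) ^ 2 * (S.dim * c ^ 4) := by gcongr
    _ = _ := by unfold fourthMomentConst; ring

variable (S)

/-- The energy per spin. -/
noncomputable def energyDensity (j : Fin (q ^ S.sites.card)) : ℝ := S.energy j / S.N

/-- The leading term is the part of `∑ |⟨j|A|j⟩|² / d` that linear regression on the energy density
explains. Both quotients are zero if all energies vanish. -/
lemma leading_eq (hN : 0 < S.N) (A : S.Op) :
    S.leading A = ‖∑ j, (S.energyDensity j : ℂ) * S.eev A j‖ ^ 2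
      / (∑ j, S.energyDensity j ^ 2) / S.dim := by
  have hN' : (S.N : ℝ) ≠ 0 := by positivity
  have h1 : ∑ j, (S.energyDensity j : ℂ) * S.eev A j = (S.H * A).trace / S.N := by
    rw [← sum_energy_mul_eev, Finset.sum_div]
    exact Finset.sum_congr rfl fun j _ => by unfold energyDensity; push_cast; ring
  have h2 : ∑ j, S.energyDensity j ^ 2 = (S.H * S.H).trace.re / (S.N : ℝ) ^ 2 := by
    rw [← sum_energy_sq, Complex.ofReal_re, Finset.sum_div]
    exact Finset.sum_congr rfl fun j _ => by unfold energyDensity; rw [div_pow]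
  rw [h1, h2, leading, norm_div, Complex.norm_natCast, div_pow,
    div_div_div_cancel_right₀ (pow_ne_zero 2 hN'), div_div, mul_comm (S.dim : ℝ)]

lemma energy_eq (hN : 0 < S.N) (j) : S.energy j = S.N * S.energyDensity j := by
  have hN' : (S.N : ℝ) ≠ 0 := by positivity
  unfold energyDensity; field_simp

lemma filter_subset_window (hN : 0 < S.N) {θ δ₁ δ₂ : ℝ} (h1 : θ ≤ δ₁) (h2 : θ ≤ δ₂) :
    (univ.filter fun j => |S.energyDensity j| ≤ θ) ⊆ S.window δ₁ δ₂ := by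
  intro j hj
  have hj' := abs_le.mp (Finset.mem_filter.mp hj).2
  simp only [window, Finset.mem_filter, Finset.mem_univ, true_and, S.energy_eq hN, ← mul_neg]
  exact ⟨mul_le_mul_of_nonneg_left (by linarith [hj'.1]) (Nat.cast_nonneg _),
    mul_le_mul_of_nonneg_left (by linarith [hj'.2]) (Nat.cast_nonneg _)⟩

lemma filter_subset_localWindow (hN : 0 < S.N) {θ δ₃ : ℝ} (h3 : θ ≤ δ₃ / 2) {j}
    (hj : j ∈ univ.filter fun j => |S.energyDensity j| ≤ θ) :
    (univ.filter fun j => |S.energyDensity j| ≤ θ) ⊆ S.localWindow δ₃ j := by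
  intro l hl
  have hj' := abs_le.mp (Finset.mem_filter.mp hj).2
  have hl' := abs_le.mp (Finset.mem_filter.mp hl).2
  simp only [localWindow, Finset.mem_filter, Finset.mem_univ, true_and, S.energy_eq hN]
  rw [← mul_sub, abs_mul, Nat.abs_cast]
  refine mul_le_mul_of_nonneg_left (abs_le.mpr ?_) (Nat.cast_nonneg _)
  constructor <;> linarith [hj'.1, hj'.2, hl'.1, hl'.2]

/-- If `tr (H²) / d` is at most `β N` and `|tr (H A)| / d` at least `κ`, then the leading term is at
least `κ² / (β N)`. -/
lemma le_leading (hN : 0 < S.N) (hd : 0 < S.dim) {A : S.Op} {κ β : ℝ} (hκ : 0 < κ) (hβ : 0 < β)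
    (hx2 : ∑ j, S.energyDensity j ^ 2 ≤ β / S.N * S.dim)
    (hHA : κ * (S.dim : ℝ) ≤ ‖(S.H * A).trace‖) : κ ^ 2 / β / S.N ≤ S.leading A := by
  have hN' : (0 : ℝ) < S.N := by exact_mod_cast hN
  have hd' : (0 : ℝ) < S.dim := by exact_mod_cast hd
  have hH2 : (S.H * S.H).trace.re ≤ β * S.N * S.dim := by
    rw [← sum_energy_sq, Complex.ofReal_re]
    simp only [S.energy_eq hN, mul_pow, ← Finset.mul_sum]
    calc _ ≤ (S.N : ℝ) ^ 2 * (β / S.N * S.dim) := by gcongr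
      _ = _ := by field_simp
  -- The quotient is not a division by zero: if all energies vanish, then so does `tr (H A)`.
  have hH2pos : 0 < (S.H * S.H).trace.re := by
    rw [← sum_energy_sq, Complex.ofReal_re]
    refine (Finset.sum_nonneg fun j _ => sq_nonneg _).lt_of_ne' fun h0 => ?_
    have := sum_mul_eq_zero_of_sum_sq (S.eev A) S.energy h0
    rw [sum_energy_mul_eev] at this
    rw [this, norm_zero] at hHA
    exact absurd hHA (not_le.mpr (mul_pos hκ hd'))
  unfold leading
  rw [div_div, le_div_iff₀ (by positivity)]
  calc κ ^ 2 / (β * S.N) * (S.dim * (S.H * S.H).trace.re)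
      ≤ κ ^ 2 / (β * S.N) * (S.dim * (β * S.N * S.dim)) := by gcongr
    _ = (κ * S.dim) ^ 2 := by field_simp
    _ ≤ _ := by gcongr

/-- The coefficient of the quadratic error in the affine approximation of the eigenstate
expectation values as a function of the energy density. The first term is the Taylor remainder; the
other two take care of the tails of the spectrum. -/
noncomputable def quadraticErrorConst (ε M : ℝ) (k : ℕ) : ℝ :=
  M * ∑ m ∈ range k, ε ^ m + ((1 + M) / ε ^ 2 + M / ε)

variable {S}

/-- Eigenstate thermalization makes the expectation values an affine function of the energy density
up to a quadratic error. Outside the range of the assumption, this holds for the trivial reason that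
the expectation values are bounded. -/
lemma ETH.exists_affine {ε M : ℝ} (hε : 0 < ε) (hM : 0 < M) {k p : ℕ} (hk : 1 ≤ k) (hp : 1 ≤ p)
    {A : S.Op} (hA : opNorm A = 1) (hN : 1 ≤ S.N) (h : S.ETH ε M k p A) :
    ∃ u s : ℂ, ‖s‖ ≤ M ∧ ∀ j, ‖S.eev A j - u - s * S.energyDensity j‖
      ≤ M / S.N + quadraticErrorConst ε M k * S.energyDensity j ^ 2 := by
  obtain ⟨f, -, ⟨t, ht, hf⟩, hE⟩ := h
  have hN1 : (1 : ℝ) ≤ S.N := by exact_mod_cast hN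
  have hN0 : (0 : ℝ) < S.N := by linarith
  refine ⟨t 0, t 1, ht 1 hk, fun j => ?_⟩
  set x := S.energyDensity j with hx
  have hsum : 0 ≤ M * ∑ m ∈ range k, ε ^ m := by positivity
  have htail : 0 ≤ (1 + M) / ε ^ 2 + M / ε := by positivity
  unfold quadraticErrorConst
  rcases le_or_gt |x| ε with hxε | hxε
  · have h1 : ‖S.eev A j - f x‖ ≤ M / S.N := by
      refine (hE j ?_).trans ?_
      · rw [hx, energyDensity, abs_div, abs_of_pos hN0, div_le_iff₀ hN0] at hxε
        linarith
      · gcongr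
        exact le_self_pow₀ hN1 (by omega)
    have h2 := norm_sub_affine_le hk hM.le ht hxε (hf x hxε)
    calc ‖S.eev A j - t 0 - t 1 * x‖ = ‖(S.eev A j - f x) + (f x - t 0 - t 1 * x)‖ := by
          congr 1; ring
      _ ≤ M / S.N + (M * ∑ m ∈ range k, ε ^ m) * x ^ 2 := (norm_add_le _ _).trans (add_le_add h1 h2)
      _ ≤ _ := by
          have : 0 ≤ ((1 + M) / ε ^ 2 + M / ε) * x ^ 2 := by positivity
          linarith
  · have h1 : ‖S.eev A j - t 0 - t 1 * x‖ ≤ 1 + M + M * |x| := by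
      refine (norm_sub_le _ _).trans (add_le_add ((norm_sub_le _ _).trans (add_le_add ?_ ?_)) ?_)
      · exact (S.norm_eev_le A j).trans_eq hA
      · exact ht 0 (Nat.zero_le _)
      · rw [norm_mul, Complex.norm_real, Real.norm_eq_abs]
        exact mul_le_mul_of_nonneg_right (ht 1 hk) (abs_nonneg _)
    have h2 : 1 + M ≤ (1 + M) / ε ^ 2 * x ^ 2 := by
      rw [div_mul_eq_mul_div, le_div_iff₀ (by positivity), ← sq_abs x]
      gcongr
    have h3 : M * |x| ≤ M / ε * x ^ 2 := by
      rw [div_mul_eq_mul_div, le_div_iff₀ hε, ← sq_abs x]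
      nlinarith [mul_pos hM (hε.trans hxε)]
    have h4 : 0 ≤ (M * ∑ m ∈ range k, ε ^ m) * x ^ 2 := by positivity
    have h5 : 0 ≤ M / S.N := by positivity
    linarith

lemma HasLocalHamiltonian.sum_energyDensity {r : ℕ} {a b c : ℝ}
    (hS : S.HasLocalHamiltonian r a b c) : ∑ j, S.energyDensity j = 0 := by
  simp only [energyDensity, ← Finset.sum_div, hS.sum_energy_eq_zero, zero_div]

lemma HasLocalHamiltonian.sum_energyDensity_pow_four_le (hq : q ≠ 0) {r : ℕ} {a b c : ℝ}
    (hc : 0 < c) (hN : 0 < S.N) (hS : S.HasLocalHamiltonian r a b c) :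
    ∑ j, S.energyDensity j ^ 4 ≤ (√(fourthMomentConst D r c) / S.N) ^ 2
      * Fintype.card (Fin (q ^ S.sites.card)) := by
  have hN' : (0 : ℝ) < S.N := by exact_mod_cast hN
  simp only [energyDensity, div_pow, ← Finset.sum_div]
  rw [Real.sq_sqrt (fourthMomentConst_pos D r hc).le, S.card_levels, div_le_iff₀ (by positivity)]
  refine (hS.sum_energy_pow_four_le hq hc.le).trans_eq ?_
  field_simp

/-- The bounds behind all three parts: the fluctuations agree with the leading term up to `O(1/N²)`,
and the leading term is `O(1/N)`, and at least of this order if `|tr (H A)|` is of order `d`. -/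
theorem exists_uniform_bounds (D q r : ℕ) (hq : q ≠ 0) (a b c : ℝ) (hc : 0 < c)
    (δ₁ δ₂ δ₃ : ℝ) (hδ₁ : 0 < δ₁) (hδ₂ : 0 < δ₂) (hδ₃ : 0 < δ₃)
    (ε M : ℝ) (hε : 0 < ε) (hM : 0 < M) (k p : ℕ) (hk : 1 ≤ k) (hp : 1 ≤ p) :
    ∃ (C β B : ℝ) (N₀ : ℕ), 0 < C ∧ 0 < β ∧ 0 < B ∧ 1 ≤ N₀ ∧
      ∀ (S : SpinSystem D q) (A : S.Op), N₀ ≤ S.N →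
      S.HasLocalHamiltonian r a b c → S.IsLocalObservable r A → S.ETH ε M k p A →
        |S.fluct δ₁ δ₂ A - S.leading A| ≤ C / (S.N : ℝ) ^ 2 ∧
        |S.fluct' δ₁ δ₂ δ₃ A - S.leading A| ≤ C / (S.N : ℝ) ^ 2 ∧
        S.leading A ≤ B / S.N ∧
        ∀ κ : ℝ, 0 < κ → κ * (S.dim : ℝ) ≤ ‖(S.H * A).trace‖ → κ ^ 2 / β / S.N ≤ S.leading A := by
  set β := √(fourthMomentConst D r c) with hβ
  have hβ0 : 0 < β := Real.sqrt_pos.mpr (fourthMomentConst_pos D r hc)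
  set L := quadraticErrorConst ε M k with hL
  -- Both windows contain all levels with energy density at most `θ`.
  set θ := min (min δ₁ δ₂) (δ₃ / 2) with hθ
  have hθ0 : 0 < θ := by positivity
  have hθ1 : θ ≤ δ₁ := (min_le_left _ _).trans (min_le_left _ _)
  have hθ2 : θ ≤ δ₂ := (min_le_left _ _).trans (min_le_right _ _)
  have hθ3 : θ ≤ δ₃ / 2 := min_le_right _ _
  set R := 2 * M ^ 2 + 2 * L ^ 2 * β ^ 2 with hR
  have hR0 : 0 < R := by positivity
  refine ⟨22 * (β ^ 2 / θ ^ 4) + R, β, 2 * R + 2 * M ^ 2 * β, ⌈2 * (β ^ 2 / θ ^ 4)⌉₊ + 1,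
    by positivity, hβ0, by positivity, by omega, ?_⟩
  intro S A hNS hH ⟨_, htr, hA⟩ hETH
  have hN1 : 1 ≤ S.N := by omega
  have hN1' : (1 : ℝ) ≤ S.N := by exact_mod_cast hN1
  have hN0 : (0 : ℝ) < S.N := by linarith
  have hd : 0 < S.dim := Nat.pow_pos (Nat.pos_of_ne_zero hq)
  have hd' : (0 : ℝ) < S.dim := by exact_mod_cast hd
  have hsumA : ∑ j, S.eev A j = 0 := by rw [S.sum_eev, htr]
  have hA1 : ∀ j, ‖S.eev A j‖ ≤ 1 := fun j => (S.norm_eev_le A j).trans_eq hA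
  have hx0 := hH.sum_energyDensity
  have hx4 := hH.sum_energyDensity_pow_four_le hq hc hN1
  rw [← hβ] at hx4
  have hx2 := sum_sq_le_of_sum_pow_four_le S.energyDensity (by positivity) hx4
  obtain ⟨u, s, hs, hus⟩ := hETH.exists_affine hε hM hk hp hA hN1
  have herr := sum_affine_error_le _ _ u s hus hx4
  rw [S.card_levels] at hx2 herr
  have hRN : 2 * (M / S.N) ^ 2 + 2 * L ^ 2 * (β / S.N) ^ 2 = R / (S.N : ℝ) ^ 2 := by
    rw [hR]; field_simp
  rw [← hL, hRN] at herr
  set η := β ^ 2 / θ ^ 4 / (S.N : ℝ) ^ 2 with hη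
  have hη2 : η ≤ 1 / 2 := by
    have h1 : 2 * (β ^ 2 / θ ^ 4) ≤ S.N := by
      refine (Nat.le_ceil _).trans ?_
      exact_mod_cast (Nat.le_succ _).trans hNS
    rw [hη, div_le_iff₀ (by positivity)]
    nlinarith
  have hG : ((univ.filter fun j => |S.energyDensity j| ≤ θ)ᶜ.card : ℝ)
      ≤ η * Fintype.card (Fin (q ^ S.sites.card)) := by
    refine (card_filter_gt_le S.energyDensity hθ0 hx4).trans_eq ?_
    rw [hη]; field_simp
  have hsumsq := residual_le _ _ hsumA hx0 u s
  have hexpl := explained_le (S.eev A) S.energyDensity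
  have hlead := S.leading_eq hN1 A
  set T := ‖∑ j, (S.energyDensity j : ℂ) * S.eev A j‖ ^ 2 / ∑ j, S.energyDensity j ^ 2
  set W := ∑ j, ‖S.eev A j‖ ^ 2 with hW
  have hVT : |W / S.dim - S.leading A| ≤ R / (S.N : ℝ) ^ 2 := by
    rw [hlead, ← sub_div, abs_of_nonneg (div_nonneg (by linarith) hd'.le), div_le_iff₀ hd']
    exact hsumsq.trans herr
  have hJ : (univ.filter fun j => |S.energyDensity j| ≤ θ) ⊆ S.window δ₁ δ₂ :=
    S.filter_subset_window hN1 hθ1 hθ2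
  have hcardpos : 0 < Fintype.card (Fin (q ^ S.sites.card)) := by rwa [S.card_levels]
  have hcombine : ∀ K : Fin (q ^ S.sites.card) → Finset (Fin (q ^ S.sites.card)),
      (∀ j ∈ (univ.filter fun j => |S.energyDensity j| ≤ θ),
        (univ.filter fun j => |S.energyDensity j| ≤ θ) ⊆ K j) →
      |localDeviation (S.window δ₁ δ₂) K (S.eev A) - S.leading A|
        ≤ (22 * (β ^ 2 / θ ^ 4) + R) / (S.N : ℝ) ^ 2 := by
    intro K hK'
    have h := abs_localDeviation_sub_le _ hsumA hA1 hcardpos hη2 _ _ K hG hJ hK'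
    rw [S.card_levels, ← hW] at h
    refine (abs_sub_le _ (W / S.dim) _).trans ((add_le_add h hVT).trans_eq ?_)
    rw [hη]; ring
  refine ⟨hcombine (fun _ => S.window δ₁ δ₂) fun _ _ => hJ, hcombine _ fun _ =>
    S.filter_subset_localWindow hN1 hθ3, ?_, fun κ hκ => S.le_leading hN1 hd hκ hβ0 hx2⟩
  · have h1 : W ≤ ∑ j, ‖S.eev A j - u‖ ^ 2 := by
      rw [sum_norm_sub_const_sq _ u hsumA]
      have : (0 : ℝ) ≤ Fintype.card (Fin (q ^ S.sites.card)) * ‖u‖ ^ 2 := by positivity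
      linarith
    have h2 := sum_norm_sub_const_sq_le (S.eev A) S.energyDensity u s hs
    rw [hlead, div_le_iff₀ hd']
    refine (hexpl.trans (h1.trans h2)).trans ?_
    have h4 : R / (S.N : ℝ) ^ 2 ≤ R / S.N := by
      gcongr
      exact le_self_pow₀ hN1' two_ne_zero
    calc _ ≤ 2 * (R / (S.N : ℝ) ^ 2 * S.dim) + 2 * M ^ 2 * (β / S.N * S.dim) := by gcongr
      _ ≤ 2 * (R / S.N * S.dim) + 2 * M ^ 2 * (β / S.N * S.dim) := by gcongr
      _ = _ := by ring

end SpinSystem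

/-! ### Asymptotics in the number of spins -/

/-- A constant multiple of `q ^ (-N/2)` is eventually smaller than any positive multiple of `1/N`. -/
lemma exists_mul_rpow_neg_half_lt (q : ℕ) (hq : 2 ≤ q) (K C : ℝ) (hC : 0 < C) :
    ∃ N₀ : ℕ, ∀ n : ℕ, N₀ ≤ n → K * ((q ^ n : ℕ) : ℝ) ^ (-(1 / 2) : ℝ) < C / n := by
  have hq' : (1 : ℝ) < q := by exact_mod_cast hq
  set ρ : ℝ := (q : ℝ) ^ (-(1 / 2) : ℝ) with hρ
  have hρ0 : 0 ≤ ρ := by positivity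
  have hρ1 : ρ < 1 := Real.rpow_lt_one_of_one_lt_of_neg hq' (by norm_num)
  have hlim := (tendsto_self_mul_const_pow_of_lt_one hρ0 hρ1).const_mul K
  rw [mul_zero] at hlim
  obtain ⟨N₁, hN₁⟩ := Filter.eventually_atTop.mp (hlim.eventually (gt_mem_nhds hC))
  refine ⟨max N₁ 1, fun n hn => ?_⟩
  have hn0 : (0 : ℝ) < n := by exact_mod_cast (le_max_right _ _).trans hn
  have e : ((q ^ n : ℕ) : ℝ) ^ (-(1 / 2) : ℝ) = ρ ^ n := by
    rw [hρ, Nat.cast_pow, ← Real.rpow_natCast, ← Real.rpow_natCast, ← Real.rpow_mul (by positivity),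
      ← Real.rpow_mul (by positivity), mul_comm]
  rw [e, lt_div_iff₀ hn0]
  calc _ = K * (n * ρ ^ n) := by ring
    _ < C := hN₁ n ((le_max_left _ _).trans hn)

theorem theorem1 (D q r : ℕ) (hq : 2 ≤ q)
    (a b c : ℝ) (ha : 0 < a) (hb : 0 < b) (hc : 0 < c)
    (δ₁ δ₂ δ₃ : ℝ) (hδ₁ : 0 < δ₁) (hδ₂ : 0 < δ₂) (hδ₃ : 0 < δ₃)
    (ε M : ℝ) (hε : 0 < ε) (hM : 0 < M) (k p : ℕ) (hk : 1 ≤ k) (hp : 1 ≤ p) :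
    -- both fluctuation measures equal the leading term up to `O(1/N²)`
    (∃ (C : ℝ) (N₀ : ℕ), 0 < C ∧ ∀ (S : SpinSystem D q) (A : S.Op), N₀ ≤ S.N →
      S.HasLocalHamiltonian r a b c → S.IsLocalObservable r A → S.ETH ε M k p A →
        |S.fluct δ₁ δ₂ A - S.leading A| ≤ C / (S.N : ℝ) ^ 2 ∧
        |S.fluct' δ₁ δ₂ δ₃ A - S.leading A| ≤ C / (S.N : ℝ) ^ 2) ∧
    -- if `|tr (H A)| / d` is bounded away from `0`, both are `Θ(1/N)`
    (∀ κ : ℝ, 0 < κ → ∃ (C₁ C₂ : ℝ) (N₀ : ℕ), 0 < C₁ ∧ 0 < C₂ ∧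
      ∀ (S : SpinSystem D q) (A : S.Op), N₀ ≤ S.N →
      S.HasLocalHamiltonian r a b c → S.IsLocalObservable r A → S.ETH ε M k p A →
      κ * (S.dim : ℝ) ≤ ‖(S.H * A).trace‖ →
        (C₁ / (S.N : ℝ) ≤ S.fluct δ₁ δ₂ A ∧ S.fluct δ₁ δ₂ A ≤ C₂ / (S.N : ℝ)) ∧
        (C₁ / (S.N : ℝ) ≤ S.fluct' δ₁ δ₂ δ₃ A ∧ S.fluct' δ₁ δ₂ δ₃ A ≤ C₂ / (S.N : ℝ))) ∧
    -- in that case both eventually exceed every constant multiple of `d ^ (-1/2)`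
    (∀ κ : ℝ, 0 < κ → ∀ K : ℝ, ∃ N₀ : ℕ,
      ∀ (S : SpinSystem D q) (A : S.Op), N₀ ≤ S.N →
      S.HasLocalHamiltonian r a b c → S.IsLocalObservable r A → S.ETH ε M k p A →
      κ * (S.dim : ℝ) ≤ ‖(S.H * A).trace‖ →
        K * (S.dim : ℝ) ^ (-(1 / 2) : ℝ) < S.fluct δ₁ δ₂ A ∧
        K * (S.dim : ℝ) ^ (-(1 / 2) : ℝ) < S.fluct' δ₁ δ₂ δ₃ A) := by

  obtain ⟨C, β, B, N₀, hC, hβ, hB, hN₀, hmain⟩ := SpinSystem.exists_uniform_bounds D q r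
    (by omega) a b c hc δ₁ δ₂ δ₃ hδ₁ hδ₂ hδ₃ ε M hε hM k p hk hp
  have htheta : ∀ κ : ℝ, 0 < κ → ∃ (C₁ C₂ : ℝ) (N₁ : ℕ), 0 < C₁ ∧ 0 < C₂ ∧
      ∀ (S : SpinSystem D q) (A : S.Op), N₁ ≤ S.N →
      S.HasLocalHamiltonian r a b c → S.IsLocalObservable r A → S.ETH ε M k p A →
      κ * (S.dim : ℝ) ≤ ‖(S.H * A).trace‖ →
        (C₁ / (S.N : ℝ) ≤ S.fluct δ₁ δ₂ A ∧ S.fluct δ₁ δ₂ A ≤ C₂ / (S.N : ℝ)) ∧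
        (C₁ / (S.N : ℝ) ≤ S.fluct' δ₁ δ₂ δ₃ A ∧ S.fluct' δ₁ δ₂ δ₃ A ≤ C₂ / (S.N : ℝ)) := by
    intro κ hκ
    -- Beyond `N = C / C₁` the error `C / N²` is at most `C₁ / N`, half of the lower bound.
    set C₁ := κ ^ 2 / β / 2 with hC₁
    have hC₁0 : 0 < C₁ := by positivity
    refine ⟨C₁, B + C, max N₀ ⌈C / C₁⌉₊, hC₁0, by positivity, ?_⟩
    intro S A hN hS hA hE hHA
    obtain ⟨h1, h2, h3, h4⟩ := hmain S A ((le_max_left _ _).trans hN) hS hA hE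
    have h5 := h4 κ hκ hHA
    have hN1 : (1 : ℝ) ≤ S.N := by exact_mod_cast hN₀.trans ((le_max_left _ _).trans hN)
    have hNC : C / C₁ ≤ S.N :=
      (Nat.le_ceil _).trans (by exact_mod_cast (le_max_right _ _).trans hN)
    have hN0 : (0 : ℝ) < S.N := by linarith
    have e1 : C / (S.N : ℝ) ^ 2 ≤ C₁ / S.N := by
      rw [div_le_iff₀ hC₁0] at hNC
      rw [div_le_div_iff₀ (by positivity) hN0]
      nlinarith
    have e2 : C / (S.N : ℝ) ^ 2 ≤ C / S.N := by
      gcongr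
      exact le_self_pow₀ hN1 two_ne_zero
    have e3 : κ ^ 2 / β / S.N = C₁ / S.N + C₁ / S.N := by rw [hC₁]; ring
    have e4 : (B + C) / S.N = B / S.N + C / S.N := add_div _ _ _
    rw [abs_le] at h1 h2
    refine ⟨⟨?_, ?_⟩, ⟨?_, ?_⟩⟩ <;> linarith [h1.1, h1.2, h2.1, h2.2]
  refine ⟨⟨C, N₀, hC, fun S A hN hS hA hE => ?_⟩, htheta, fun κ hκ K => ?_⟩
  · obtain ⟨h1, h2, -, -⟩ := hmain S A hN hS hA hE
    exact ⟨h1, h2⟩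
  · obtain ⟨C₁, C₂, N₁, hC₁, -, h⟩ := htheta κ hκ
    obtain ⟨N₂, hN₂⟩ := exists_mul_rpow_neg_half_lt q hq K C₁ hC₁
    refine ⟨max N₁ N₂, fun S A hN hS hA hE hHA => ?_⟩
    obtain ⟨⟨h1, -⟩, ⟨h2, -⟩⟩ := h S A ((le_max_left _ _).trans hN) hS hA hE hHA
    have h3 := hN₂ S.N ((le_max_right _ _).trans hN)
    exact ⟨h3.trans_le h1, h3.trans_le h2⟩
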